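/- Let $\mathcal K$ be a field, let $<$ be an admissible monomial order on the set $T$ of monomials of $\mathcal K[x_1,\dots,x_n]$, and let $f_1,\dots,f_m$ be nonzero homogeneous polynomials (no regularity is assumed). $\mathrm{HM}(p)$ and $\mathrm{HC}(p)$ denote the head monomial and head coefficient of $p\neq 0$. A signature is a module monomial $tF_i$ with $t\in T$, $1\le i\le m$; signatures are ordered by $tF_i\prec t'F_j$ iff $i>j$, or $i=j$ and $t<t'$; and $S\mid S'$ means $S'=vS$ for some $v\in T$. A labeled polynomial $r$ has a signature $\mathcal S(r)$ and a polynomial $\mathrm{poly}(r)$; write $\mathrm{HM}(r)=\mathrm{HM}(\mathrm{poly}(r))$. For quotients of monomials put $\frac{m_1}{m_2}>_q\frac{m_3}{m_4}$ iff $m_1m_4>m_3m_2$; in $\mathrm{HM}(r)/\mathcal S(r)$ the denominator is the monomial of the signature. Consider Faugère's original F5 algorithm on the input $f_1,\dots,f_m$. It keeps a list $R$ of labeled polynomials in order of generation, beginning with the inputs $r_i=(F_i,\mathrm{HC}(f_i)^{-1}f_i)$, and for each index a list of rules (the pairs of a signature and a generated polynomial), newest first. $G_{m+1}=\emptyset$,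 and for $i=m,m-1,\dots,1$ the procedure AlgorithmF5 computes $G_i$ as follows, where $\varphi_j$ denotes a normal form modulo $\mathrm{poly}(G_j)$, and $\varphi=\varphi_{i+1}$. * Put $G_i=G_{i+1}\cup\{r_i\}$ and let $P$ be the set of critical pairs of $r_i$ with the elements of $G_{i+1}$. The critical pair of $r,r'$ consists of $t=\mathrm{lcm}(\mathrm{HM}(r),\mathrm{HM}(r'))$ and the parts $u\cdot r$, $u'\cdot r'$ with $u=t/\mathrm{HM}(r)$, $u'=t/\mathrm{HM}(r')$, the part of greater signature first. It is discarded if the first part has index $>i$ or if a part of index $i$ fails the normal form check, i.e. $\varphi(us)\ne us$, where $s$ is the monomial of the signature of $r$ (and the same for $u'$, $r'$). (A part of index $j>i$ may be tested with $\varphi_{j+1}$ or not be tested; the statement covers both variants.) * While $P\ne\emptyset$: remove from $P$ all pairs of minimal degree $\deg t$. For each of them (Spol), unless one of its two parts is rewritten, generate a new labeled polynomial with the signature of the first part and the S-polynomial, append it to $R$, add its rule and put it into $ToDo$. A part $u\cdot r$ is rewritten if the newest rule of the index of $r$ whose signature divides $u\mathcal S(r)$ exists and belongs to a polynomial other than $r$.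 * Reduction: let $Done=\emptyset$. While $ToDo\neq\emptyset$, take an element $h$ of minimal signature and replace $\mathrm{poly}(h)$ by $\varphi(\mathrm{poly}(h))$. If it is $0$, drop $h$. Otherwise look for a reductor $r\in G_i\cup Done$ such that (a) $u=\mathrm{HM}(h)/\mathrm{HM}(r)\in T$, (b) $u\cdot r$ passes the normal form check, (c) $u\cdot r$ is not rewritten, and (d) $u\mathcal S(r)\neq\mathcal S(h)$. If there is none, make $h$ monic and move it to $Done$. If $u\mathcal S(r)\prec\mathcal S(h)$, cancel the head term of $h$ with $u\cdot r$ and leave $h$ in $ToDo$. If $u\mathcal S(r)\succ\mathcal S(h)$, leave $h$ in $ToDo$ and generate a new labeled polynomial with signature $u\mathcal S(r)$ and the S-polynomial of $r$ and $h$, append it to $R$, add its rule and put it into $ToDo$. * Then, for every $r\in Done$ in turn, add to $P$ the critical pairs of $r$ with the elements of $G_i$ and add $r$ to $G_i$. Ties and choices (the order in which pairs are processed, the element of minimal signature, the reductor, the reduction steps in a normal form) may be resolved in any way. Let $G$ denote the set $G_i$ of the current call. **Theorem.** If the algorithm does not terminate, i.e. for every infinite run of it, there are two labeled polynomials $f',f$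 with nonzero polynomials, $f$ generated after $f'$ (it stands at a later position of $R$), such that from some finite step on $G$ contains both of them and $$\mathrm{HM}(f')\mid\mathrm{HM}(f),\qquad \frac{\mathrm{HM}(f')}{\mathcal S(f')}>_q\frac{\mathrm{HM}(f)}{\mathcal S(f)},\qquad \mathcal S(f')\mid\mathcal S(f).$$ -/

import Mathlib

namespace F5

open MvPolynomial

noncomputable section

/-- A module monomial `t F_i`; a monomial is given by its exponent vector.  The input polynomials
are numbered `0, …, m - 1`. -/
structure Sig (n : ℕ) where
  mono : Fin n →₀ ℕ
  idx : ℕ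

/-- The multiple `u · (t F_i) = (u t) F_i`. -/
def Sig.mul {n : ℕ} (u : Fin n →₀ ℕ) (S : Sig n) : Sig n := ⟨u + S.mono, S.idx⟩

/-- The signature order: `F_0 ≻ F_1 ≻ ⋯`, and the given monomial order within one index. -/
def Sig.Lt {n : ℕ} (ord : MonomialOrder (Fin n)) (S T : Sig n) : Prop :=
  T.idx < S.idx ∨ (S.idx = T.idx ∧ ord.toSyn S.mono < ord.toSyn T.mono)

/-- Divisibility of signatures: `T = v · S` for a monomial `v`. -/
def Sig.Dvd {n : ℕ} (S T : Sig n) : Prop := ∃ v : Fin n →₀ ℕ, T = Sig.mul v S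

/-- The order on quotients of monomials: `a / b >_q c / d` iff `a d > c b`. -/
def QuotGt {n : ℕ} (ord : MonomialOrder (Fin n)) (a b c d : Fin n →₀ ℕ) : Prop :=
  ord.toSyn (c + b) < ord.toSyn (a + d)

/-- A labeled polynomial `(S(r), poly(r))`. -/
structure Labeled (n : ℕ) (K : Type*) [Field K] where
  sig : Sig n
  poly : MvPolynomial (Fin n) K

/-- A critical pair `[t, u₁, r₁, u₂, r₂]`; labeled polynomials are given by their positions. -/
structure CritPair (n : ℕ) where
  t : Fin n →₀ ℕ
  u₁ : Fin n →₀ ℕ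
  r₁ : ℕ
  u₂ : Fin n →₀ ℕ
  r₂ : ℕ

section Polynomials

variable {n : ℕ} {K : Type*} [Field K] (ord : MonomialOrder (Fin n))

/-- `HC(p)⁻¹ p`. -/
def monic (p : MvPolynomial (Fin n) K) : MvPolynomial (Fin n) K :=
  C (ord.leadingCoeff p)⁻¹ * p

/-- The S-polynomial `u HC(p)⁻¹ p - v HC(q)⁻¹ q`. -/
def spoly (u : Fin n →₀ ℕ) (p : MvPolynomial (Fin n) K) (v : Fin n →₀ ℕ)
    (q : MvPolynomial (Fin n) K) : MvPolynomial (Fin n) K :=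
  monomial u 1 * monic ord p - monomial v 1 * monic ord q

/-- One reduction step modulo `B`: a term of `p` divisible by `HM(g)` is cancelled using a monomial
multiple of `g ∈ B`. -/
def ReducesTo (B : Set (MvPolynomial (Fin n) K)) (p q : MvPolynomial (Fin n) K) : Prop :=
  ∃ g ∈ B, g ≠ 0 ∧ ∃ u : Fin n →₀ ℕ, p.coeff (u + ord.degree g) ≠ 0 ∧
    q = p - monomial u (p.coeff (u + ord.degree g) / ord.leadingCoeff g) * g

/-- `q` is a normal form of `p` modulo `B`: it is reached by reduction steps and is irreducible. -/
def IsNormalForm (B : Set (MvPolynomial (Fin n) K)) (p q : MvPolynomial (Fin n) K) : Prop :=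
  Relation.ReflTransGen (ReducesTo ord B) p q ∧ ∀ q', ¬ ReducesTo ord B q q'

end Polynomials

/-- The program points of the algorithm.
* `call`: between two calls of `AlgorithmF5`;
* `loop`: the head of the `while` loop of `AlgorithmF5`;
* `spol`: inside the loop of `Spol`;
* `reduce`: the head of the `while` loop of `Reduction`;
* `update`: inside the loop of `AlgorithmF5` over `R_d`. -/
inductive Phase
  | call
  | loop
  | spol
  | reduce
  | update

/-- A state of the algorithm.
* `pc`: the program point;
* `i`: the index treated by the current call of `AlgorithmF5` (at the point `call`: by the
  preceding call; initially the number of input polynomials);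
* `N`, `R`: the array `R` of the labeled polynomials generated so far, at positions
  `0, …, N - 1`, in order of generation (the first `m` are the input polynomials);
* `Rule j`: the list of rules of index `j`, the newest first;
* `G j`: the set `G_j` of positions in `R`;
* `P`: the set of critical pairs; `Pd`: those of minimal degree that `Spol` still has to process;
* `ToDo`, `Done`: the sets used by `Reduction`; `ToDo` also collects the output `F` of `Spol`, and
  at the point `update` the set `Done` is what is left of `R_d`. -/
structure State (n : ℕ) (K : Type*) [Field K] where
  pc : Phase
  i : ℕ
  N : ℕ
  R : ℕ → Labeled n K
  Rule : ℕ → List ((Fin n →₀ ℕ) × ℕ)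
  G : ℕ → Finset ℕ
  P : Finset (CritPair n)
  Pd : Finset (CritPair n)
  ToDo : Finset ℕ
  Done : Finset ℕ

namespace State

variable {n : ℕ} {K : Type*} [Field K] (ord : MonomialOrder (Fin n)) (s : State n K)

/-- `HM(r_k)`. -/
def HM (k : ℕ) : Fin n →₀ ℕ := ord.degree (s.R k).poly

/-- The signature `S(r_k)`. -/
def S (k : ℕ) : Sig n := (s.R k).sig

/-- `q` is a value of the normal form operator `φ_j` at `p`: a normal form modulo `poly(G_j)`. -/
def Phi (j : ℕ) (p q : MvPolynomial (Fin n) K) : Prop :=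
  IsNormalForm ord ((fun k => (s.R k).poly) '' (s.G j : Set ℕ)) p q

/-- The normal form check for `u · r_k`, where `S(r_k) = t F_j`: `φ_{j+1}(u t) = u t`.
The check is made if `j` is the current index; for larger `j` it is made iff `full` holds. -/
def NormalCheck (full : Prop) (u : Fin n →₀ ℕ) (k : ℕ) : Prop :=
  ((s.S k).idx = s.i ∨ full) →
    Phi ord s ((s.S k).idx + 1) (monomial (u + (s.S k).mono) 1) (monomial (u + (s.S k).mono) 1)

/-- `Rewritten?(u, r_k)`: the newest rule `(t, l)` of the index of `r_k` whose monomial divides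
the monomial of `u · S(r_k)` exists and belongs to another labeled polynomial `r_l`. -/
def Rewritten (u : Fin n →₀ ℕ) (k : ℕ) : Prop :=
  ∃ r, (s.Rule (s.S k).idx).find? (fun r => decide (r.1 ≤ u + (s.S k).mono)) = some r ∧ r.2 ≠ k

open Classical in
/-- The critical pair of `r_k` and `r_l`, the part with the greater signature first. -/
def mkPair (k l : ℕ) : CritPair n :=
  let t := s.HM ord k ⊔ s.HM ord l
  let u := t - s.HM ord k
  let v := t - s.HM ord l
  if (Sig.mul u (s.S k)).Lt ord (Sig.mul v (s.S l)) then ⟨t, v, l, u, k⟩ else ⟨t, u, k, v, l⟩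

/-- The conditions under which `CritPair` does not discard the pair. -/
def PairOK (full : Prop) (p : CritPair n) : Prop :=
  (s.S p.r₁).idx ≤ s.i ∧ s.NormalCheck ord full p.u₁ p.r₁ ∧ s.NormalCheck ord full p.u₂ p.r₂

open Classical in
/-- The set of all `CritPair(r_k, r_l)`, `l ∈ A`. -/
def newPairs (full : Prop) (k : ℕ) (A : Finset ℕ) : Finset (CritPair n) :=
  (A.image (s.mkPair ord k)).filter (s.PairOK ord full)

/-- `N := N + 1; r_N := (S, p); Add Rule(r_N)`, and `r_N` is added to `ToDo`. -/
def generate (S : Sig n) (p : MvPolynomial (Fin n) K) : State n K :=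
  { s with
    N := s.N + 1
    R := Function.update s.R s.N ⟨S, p⟩
    Rule := Function.update s.Rule S.idx ((S.mono, s.N) :: s.Rule S.idx)
    ToDo := insert s.N s.ToDo }

/-- Change `poly(r_k)` into `p`, keeping the signature. -/
def setPoly (k : ℕ) (p : MvPolynomial (Fin n) K) : State n K :=
  { s with R := Function.update s.R k ⟨s.S k, p⟩ }

/-- The start of the call of `AlgorithmF5` for the input polynomial `j`. -/
def startCall (full : Prop) (j : ℕ) : State n K :=
  let s' : State n K := { s with pc := .loop, i := j, Done := ∅ }
  { s' with
    P := s'.newPairs ord full j (s.G (j + 1))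
    G := Function.update s.G j (insert j (s.G (j + 1))) }

/-- `r_l` passes the checks (a)–(d) of `IsReducible` as a reductor for `r_k`. -/
def IsReductor (full : Prop) (k l : ℕ) : Prop :=
  s.HM ord l ≤ s.HM ord k ∧
  s.NormalCheck ord full (s.HM ord k - s.HM ord l) l ∧
  ¬ s.Rewritten (s.HM ord k - s.HM ord l) l ∧
  Sig.mul (s.HM ord k - s.HM ord l) (s.S l) ≠ s.S k

/-- `r_k` is a possible choice of the next element of `ToDo`: its signature is minimal. -/
def IsFirst (k : ℕ) : Prop := k ∈ s.ToDo ∧ ∀ l ∈ s.ToDo, ¬ (s.S l).Lt ord (s.S k)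

end State

open Classical in
/-- One step of the algorithm.  Choices which the pseudo-code makes by the order of a list with
ties (which critical pair, which element of minimal signature, which reductor, which reductions in
the normal form) are left open, so that every way of making them is covered. -/
inductive Step {n : ℕ} {K : Type*} [Field K] (ord : MonomialOrder (Fin n)) (full : Prop) :
    State n K → State n K → Prop
  /-- The outer loop calls `AlgorithmF5` for the next input polynomial. -/
  | startCall (s : State n K) (j : ℕ) (hpc : s.pc = .call) (hi : s.i = j + 1) :
      Step ord full s (s.startCall ord full j)
  /-- The call of `AlgorithmF5` returns when `P` is empty. -/
  | endCall (s : State n K) (hpc : s.pc = .loop) (hP : s.P = ∅) :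
      Step ord full s { s with pc := .call }
  /-- The critical pairs of minimal degree are moved from `P` to `Pd`. -/
  | select (s : State n K) (hpc : s.pc = .loop) (d : ℕ) (hd : ∃ p ∈ s.P, p.t.degree = d)
      (hmin : ∀ p ∈ s.P, d ≤ p.t.degree) :
      Step ord full s
        { s with
          pc := .spol
          Pd := s.P.filter (fun p => p.t.degree = d)
          P := s.P.filter (fun p => p.t.degree ≠ d)
          ToDo := ∅ }
  /-- `Spol` discards a critical pair with a rewritten part. -/
  | spolSkip (s : State n K) (hpc : s.pc = .spol) (p : CritPair n) (hp : p ∈ s.Pd)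
      (hrw : s.Rewritten p.u₁ p.r₁ ∨ s.Rewritten p.u₂ p.r₂) :
      Step ord full s { s with Pd := s.Pd.erase p }
  /-- `Spol` generates the S-polynomial of a critical pair without rewritten parts. -/
  | spolMake (s : State n K) (hpc : s.pc = .spol) (p : CritPair n) (hp : p ∈ s.Pd)
      (hrw₁ : ¬ s.Rewritten p.u₁ p.r₁) (hrw₂ : ¬ s.Rewritten p.u₂ p.r₂) :
      Step ord full s
        ({ s with Pd := s.Pd.erase p }.generate (Sig.mul p.u₁ (s.S p.r₁))
          (spoly ord p.u₁ (s.R p.r₁).poly p.u₂ (s.R p.r₂).poly))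
  /-- `Spol` is finished and `Reduction` starts. -/
  | spolEnd (s : State n K) (hpc : s.pc = .spol) (hPd : s.Pd = ∅) :
      Step ord full s { s with pc := .reduce, Done := ∅ }
  /-- `TopReduction` when `φ(r_k) = 0`: `r_k` is dropped. -/
  | reduceZero (s : State n K) (hpc : s.pc = .reduce) (k : ℕ) (hk : s.IsFirst ord k)
      (hφ : s.Phi ord (s.i + 1) (s.R k).poly 0) :
      Step ord full s { s.setPoly k 0 with ToDo := s.ToDo.erase k }
  /-- `TopReduction` without an admitted reductor: the monic `φ(r_k)` is moved to `Done`. -/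
  | reduceDone (s : State n K) (hpc : s.pc = .reduce) (k : ℕ) (hk : s.IsFirst ord k)
      (q : MvPolynomial (Fin n) K) (hφ : s.Phi ord (s.i + 1) (s.R k).poly q) (hq : q ≠ 0)
      (hred : ∀ l ∈ s.G s.i ∪ s.Done, ¬ (s.setPoly k q).IsReductor ord full k l) :
      Step ord full s
        { s.setPoly k (monic ord q) with
          ToDo := s.ToDo.erase k
          Done := insert k s.Done }
  /-- `TopReduction` with an admitted reductor of smaller signature: `φ(r_k)` is top-reduced and
  put back into `ToDo`. -/
  | reduceSafe (s : State n K) (hpc : s.pc = .reduce) (k : ℕ) (hk : s.IsFirst ord k)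
      (q : MvPolynomial (Fin n) K) (hφ : s.Phi ord (s.i + 1) (s.R k).poly q) (hq : q ≠ 0)
      (l : ℕ) (hl : l ∈ s.G s.i ∪ s.Done) (hred : (s.setPoly k q).IsReductor ord full k l)
      (u : Fin n →₀ ℕ) (hu : u = ord.degree q - s.HM ord l)
      (hsig : (Sig.mul u (s.S l)).Lt ord (s.S k)) :
      Step ord full s
        (s.setPoly k
          (q - monomial u (ord.leadingCoeff q / ord.leadingCoeff (s.R l).poly) * (s.R l).poly))
  /-- `TopReduction` with an admitted reductor of greater signature: `φ(r_k)` is put back into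
  `ToDo`, and the S-polynomial with the greater signature is generated. -/
  | reduceUnsafe (s : State n K) (hpc : s.pc = .reduce) (k : ℕ) (hk : s.IsFirst ord k)
      (q : MvPolynomial (Fin n) K) (hφ : s.Phi ord (s.i + 1) (s.R k).poly q) (hq : q ≠ 0)
      (l : ℕ) (hl : l ∈ s.G s.i ∪ s.Done) (hred : (s.setPoly k q).IsReductor ord full k l)
      (u : Fin n →₀ ℕ) (hu : u = ord.degree q - s.HM ord l)
      (hsig : ¬ (Sig.mul u (s.S l)).Lt ord (s.S k)) :
      Step ord full s
        ((s.setPoly k q).generate (Sig.mul u (s.S l)) (spoly ord u (s.R l).poly 0 q))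
  /-- `Reduction` is finished and returns `R_d = Done`. -/
  | reduceEnd (s : State n K) (hpc : s.pc = .reduce) (hT : s.ToDo = ∅) :
      Step ord full s { s with pc := .update }
  /-- An element of `R_d` is added to `G_i`, after its critical pairs with `G_i` were added
  to `P`. -/
  | updateAdd (s : State n K) (hpc : s.pc = .update) (k : ℕ) (hk : k ∈ s.Done) :
      Step ord full s
        { s with
          P := s.P ∪ s.newPairs ord full k (s.G s.i)
          G := Function.update s.G s.i (insert k (s.G s.i))
          Done := s.Done.erase k }
  /-- All elements of `R_d` were added. -/
  | updateEnd (s : State n K) (hpc : s.pc = .update) (hD : s.Done = ∅) :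
      Step ord full s { s with pc := .loop }

/-- The initial state for the input `f_0, …, f_{m-1}`. -/
def init {n m : ℕ} {K : Type*} [Field K] (ord : MonomialOrder (Fin n))
    (f : Fin m → MvPolynomial (Fin n) K) : State n K where
  pc := .call
  i := m
  N := m
  R := fun k => ⟨⟨0, k⟩, if h : k < m then monic ord (f ⟨k, h⟩) else 0⟩
  Rule := fun _ => []
  G := fun _ => ∅
  P := ∅
  Pd := ∅
  ToDo := ∅
  Done := ∅

/-- A run of the algorithm on the input `f` that does not terminate. -/
def IsInfiniteRun {n m : ℕ} {K : Type*} [Field K] (ord : MonomialOrder (Fin n)) (full : Prop)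
    (f : Fin m → MvPolynomial (Fin n) K) (run : ℕ → State n K) : Prop :=
  run 0 = init ord f ∧ ∀ t, Step ord full (run t) (run (t + 1))

end

end F5

/-! An infinite run generates infinitely many labeled polynomials: a lexicographic measure decreases
in every step that generates none (`Step.measure_lt`, `exists_lt_N`). Each generated polynomial has
a parent `r_l` and a multiplier `u`: its signature is `u · S(r_l)`, and its head monomial lies below
`u · HM(r_l)`, because head terms cancel (`Step.generates`).

A parent has only finitely many children. Once `u · r_l` has been used, the new rule makes all its
multiples rewritten (`Generates.rewritten`), so no multiplier divides a later one, and Dickson's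
lemma bounds their number. König's lemma then gives an infinite chain of descendants
(`exists_chain`). Along it signatures divide one another and the quotients `HM/S` strictly decrease
(`Chain.exists_mul`). Dickson's lemma for the head monomials of the chain yields the required two
elements.

It remains to see that chain elements enter `G_i` (`Chain.exists_mem_G`). A parent not yet in `G_i`
lies in `Done`, and there homogeneity forces `u = 0`. A `Reduction` that never ends would therefore
give strictly decreasing head monomials, against the well-ordering. The index `i` is eventually
constant, so elements of `G_i` then stay there. -/

namespace F5

open MvPolynomial

/-! ### Head monomials and homogeneity under reduction and S-polynomials -/

section HeadDegree

variable {n : ℕ} {K : Type*} [Field K] (ord : MonomialOrder (Fin n))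

/-- The head monomial of `p` in the monomial order, and `⊥` for `p = 0`. -/
noncomputable def headDegree (p : MvPolynomial (Fin n) K) : WithBot ord.syn :=
  p.support.sup fun c => (ord.toSyn c : WithBot ord.syn)

variable {ord} {p q g : MvPolynomial (Fin n) K} {d u : Fin n →₀ ℕ}

theorem coe_toSyn_le_headDegree (hd : p.coeff d ≠ 0) :
    (ord.toSyn d : WithBot ord.syn) ≤ headDegree ord p :=
  Finset.le_sup (f := fun c => (ord.toSyn c : WithBot ord.syn)) (mem_support_iff.2 hd)

theorem headDegree_eq_coe (hp : p ≠ 0) : headDegree ord p = ord.toSyn (ord.degree p) := by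
  apply le_antisymm
  · exact Finset.sup_le fun c hc => WithBot.coe_le_coe.2 (ord.le_degree hc)
  · exact coe_toSyn_le_headDegree (ord.coeff_degree_ne_zero_iff.2 hp)

theorem headDegree_le_coe_degree (p : MvPolynomial (Fin n) K) :
    headDegree ord p ≤ ord.toSyn (ord.degree p) :=
  Finset.sup_le fun _ hc => WithBot.coe_le_coe.2 (ord.le_degree hc)

theorem headDegree_zero : headDegree ord (0 : MvPolynomial (Fin n) K) = ⊥ := by
  simp [headDegree]

theorem headDegree_sub_le : headDegree ord (p - q) ≤ headDegree ord p ⊔ headDegree ord q := by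
  refine Finset.sup_le fun c hc => ?_
  rw [mem_support_iff, coeff_sub] at hc
  by_cases h : p.coeff c = 0
  · refine le_sup_of_le_right (coe_toSyn_le_headDegree ?_)
    rintro h'
    simp [h, h'] at hc
  · exact le_sup_of_le_left (coe_toSyn_le_headDegree h)

/-- The terms at `d` cancel. The value `⊥` of the zero polynomial keeps the inequality strict even
when the whole difference vanishes and `d = 0`. -/
theorem headDegree_sub_lt (hp : headDegree ord p ≤ ord.toSyn d)
    (hq : headDegree ord q ≤ ord.toSyn d) (h : p.coeff d = q.coeff d) :
    headDegree ord (p - q) < ord.toSyn d := by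
  rw [headDegree, Finset.sup_lt_iff (WithBot.bot_lt_coe _)]
  intro c hc
  have h1 := (coe_toSyn_le_headDegree (ord := ord) (mem_support_iff.1 hc)).trans
    headDegree_sub_le
  refine lt_of_le_of_ne (h1.trans (sup_le hp hq)) fun hcd => ?_
  have : c = d := ord.toSyn.injective (WithBot.coe_injective hcd)
  subst this
  rw [mem_support_iff, coeff_sub, h, sub_self] at hc
  exact hc rfl

theorem headDegree_monomial_mul_le (a : K) :
    headDegree ord (monomial u a * g) ≤ ord.toSyn (u + ord.degree g) := by
  refine Finset.sup_le fun c hc => ?_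
  rw [mem_support_iff, coeff_monomial_mul'] at hc
  split_ifs at hc with huc
  · have h2 := ord.le_degree (mem_support_iff.2 (right_ne_zero_of_mul hc))
    rw [WithBot.coe_le_coe, ← add_tsub_cancel_of_le huc, map_add, map_add]
    gcongr
  · exact absurd rfl hc

theorem coeff_monomial_mul_degree (a : K) :
    (monomial u a * g).coeff (u + ord.degree g) = a * ord.leadingCoeff g :=
  coeff_monomial_mul _ _ _ _

theorem ReducesTo.headDegree_le {B : Set (MvPolynomial (Fin n) K)} (h : ReducesTo ord B p q) :
    headDegree ord q ≤ headDegree ord p := by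
  obtain ⟨g, -, -, u, hu, rfl⟩ := h
  exact headDegree_sub_le.trans
    (sup_le le_rfl ((headDegree_monomial_mul_le _).trans (coe_toSyn_le_headDegree hu)))

theorem IsNormalForm.headDegree_le {B : Set (MvPolynomial (Fin n) K)}
    (h : IsNormalForm ord B p q) : headDegree ord q ≤ headDegree ord p := by
  obtain ⟨h, -⟩ := h
  induction h with
  | refl => exact le_rfl
  | tail _ h' ih => exact h'.headDegree_le.trans ih

theorem degree_degree_of_isHomogeneous {e : ℕ} (hg : g.IsHomogeneous e) (h0 : g ≠ 0) :
    (ord.degree g).degree = e := by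
  rw [Finsupp.degree_eq_weight_one]
  exact hg (ord.coeff_degree_ne_zero_iff.2 h0)

theorem isHomogeneous_monomial_mul {e : ℕ} (hg : g.IsHomogeneous e) (h0 : g ≠ 0) (a : K)
    {e' : ℕ} (he : (u + ord.degree g).degree = e') :
    (monomial u a * g).IsHomogeneous e' := by
  rw [map_add, degree_degree_of_isHomogeneous hg h0] at he
  rw [← he]
  exact (isHomogeneous_monomial a rfl).mul hg

theorem ReducesTo.isHomogeneous {B : Set (MvPolynomial (Fin n) K)} (h : ReducesTo ord B p q)
    (hB : ∀ g ∈ B, ∃ e, g.IsHomogeneous e) {e : ℕ} (hp : p.IsHomogeneous e) :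
    q.IsHomogeneous e := by
  obtain ⟨g, hg, h0, u, hu, rfl⟩ := h
  obtain ⟨e', he'⟩ := hB g hg
  refine hp.sub (isHomogeneous_monomial_mul he' h0 _ (ord := ord) ?_)
  rw [Finsupp.degree_eq_weight_one]
  exact hp hu

theorem IsNormalForm.isHomogeneous {B : Set (MvPolynomial (Fin n) K)}
    (h : IsNormalForm ord B p q) (hB : ∀ g ∈ B, ∃ e, g.IsHomogeneous e) {e : ℕ}
    (hp : p.IsHomogeneous e) : q.IsHomogeneous e := by
  obtain ⟨h, -⟩ := h
  induction h with
  | refl => exact hp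
  | tail _ h' ih => exact h'.isHomogeneous hB ih

theorem monic_ne_zero (hp : p ≠ 0) : monic ord p ≠ 0 :=
  mul_ne_zero (by simpa using hp) hp

theorem degree_monic (hp : p ≠ 0) : ord.degree (monic ord p) = ord.degree p := by
  rw [monic, ord.degree_mul (by simpa using hp) hp, ord.degree_C, zero_add]

theorem leadingCoeff_monic (hp : p ≠ 0) : ord.leadingCoeff (monic ord p) = 1 := by
  rw [MonomialOrder.leadingCoeff, degree_monic hp, monic, coeff_C_mul]
  exact inv_mul_cancel₀ (ord.leadingCoeff_ne_zero_iff.2 hp)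

theorem headDegree_monic (hp : p ≠ 0) : headDegree ord (monic ord p) = headDegree ord p := by
  rw [headDegree_eq_coe hp, headDegree_eq_coe (monic_ne_zero hp), degree_monic hp]

theorem isHomogeneous_monic {e : ℕ} (hp : p.IsHomogeneous e) : (monic ord p).IsHomogeneous e := by
  have h := (isHomogeneous_C (Fin n) (ord.leadingCoeff p)⁻¹).mul hp
  rwa [zero_add] at h

theorem headDegree_spoly_lt {v t : Fin n →₀ ℕ} (hp : p ≠ 0) (hq : q ≠ 0)
    (hu : u + ord.degree p = t) (hv : v + ord.degree q = t) :
    headDegree ord (spoly ord u p v q) < ord.toSyn t := by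
  rw [← degree_monic hp] at hu
  rw [← degree_monic hq] at hv
  refine headDegree_sub_lt (hu ▸ headDegree_monomial_mul_le _)
    (hv ▸ headDegree_monomial_mul_le _) ?_
  conv_lhs => rw [← hu, coeff_monomial_mul_degree, leadingCoeff_monic hp]
  conv_rhs => rw [← hv, coeff_monomial_mul_degree, leadingCoeff_monic hq]

theorem isHomogeneous_spoly {v t : Fin n →₀ ℕ} {e e' : ℕ} (hp : p ≠ 0) (hq : q ≠ 0)
    (hu : u + ord.degree p = t) (hv : v + ord.degree q = t) (hep : p.IsHomogeneous e)
    (heq : q.IsHomogeneous e') : (spoly ord u p v q).IsHomogeneous t.degree := by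
  rw [← degree_monic hp] at hu
  rw [← degree_monic hq] at hv
  exact (isHomogeneous_monomial_mul (isHomogeneous_monic hep) (monic_ne_zero hp) 1
    (congrArg _ hu)).sub (isHomogeneous_monomial_mul (isHomogeneous_monic heq)
      (monic_ne_zero hq) 1 (congrArg _ hv))

theorem headDegree_topReduce_lt (hp : p ≠ 0) (hg : g ≠ 0) (hu : u + ord.degree g = ord.degree p) :
    headDegree ord (p - monomial u (ord.leadingCoeff p / ord.leadingCoeff g) * g) <
      headDegree ord p := by
  rw [headDegree_eq_coe hp]
  refine headDegree_sub_lt (headDegree_le_coe_degree p)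
    (hu ▸ headDegree_monomial_mul_le _) ?_
  conv_rhs => rw [← hu, coeff_monomial_mul_degree]
  rw [div_mul_cancel₀ _ (ord.leadingCoeff_ne_zero_iff.2 hg)]
  rfl

theorem isHomogeneous_topReduce {e e' : ℕ} (hp : p ≠ 0) (hg : g ≠ 0)
    (hu : u + ord.degree g = ord.degree p) (a : K) (hep : p.IsHomogeneous e)
    (heg : g.IsHomogeneous e') : (p - monomial u a * g).IsHomogeneous e :=
  hep.sub (isHomogeneous_monomial_mul heg hg a
    (by rw [hu, degree_degree_of_isHomogeneous hep hp]))

end HeadDegree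

/-! ### Infinite paths in finitely branching forests -/

/-- König's lemma for a forest on the natural numbers, given by the parent function `par`. -/
theorem exists_chain_of_finite_fibers {m : ℕ} (par : ℕ → ℕ) (hpar : ∀ k, m ≤ k → par k < k)
    (hfin : ∀ l, {k | m ≤ k ∧ par k = l}.Finite) :
    ∃ c : ℕ → ℕ, ∀ j, m ≤ c (j + 1) ∧ par (c (j + 1)) = c j := by
  let r : ℕ → ℕ → Prop := fun l k => m ≤ k ∧ par k = l
  let D : ℕ → Set ℕ := fun l => {k | Relation.ReflTransGen r l k}
  -- The descendants of `l` are `l` itself and the descendants of its finitely many children.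
  have hstep : ∀ l, (D l).Infinite → ∃ k, r l k ∧ (D k).Infinite := by
    intro l hl
    by_contra! h
    refine hl (Set.Finite.subset ((Set.finite_singleton l).union
      ((hfin l).biUnion fun k hk => h k hk)) ?_)
    intro k hk
    rcases Relation.ReflTransGen.cases_head hk with rfl | ⟨k', h1, h2⟩
    · exact Or.inl rfl
    · exact Or.inr (Set.mem_biUnion (x := k') h1 h2)
  -- Parents are smaller, so every number descends from one of the finitely many roots below `m`.
  have hroot : ∃ l, (D l).Infinite := by
    by_contra! h
    refine Set.infinite_univ (Set.Finite.subset
      ((Set.finite_Iio m).biUnion fun k _ => h k) ?_)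
    intro k _
    induction k using Nat.strong_induction_on with
    | _ k ih =>
      by_cases hk : k < m
      · exact Set.mem_biUnion (x := k) hk Relation.ReflTransGen.refl
      · obtain ⟨l, hl, hl'⟩ := Set.mem_iUnion₂.1 (ih _ (hpar k (not_lt.1 hk)) trivial)
        exact Set.mem_biUnion (x := l) hl
          (Relation.ReflTransGen.tail hl' ⟨not_lt.1 hk, rfl⟩)
  obtain ⟨l, hl⟩ := hroot
  choose! next hnext using hstep
  have hinf : ∀ j, (D (next^[j] l)).Infinite := by
    intro j
    induction j with
    | zero => exact hl
    | succ j ih => rw [Function.iterate_succ_apply']; exact (hnext _ ih).2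
  refine ⟨fun j => next^[j] l, fun j => ?_⟩
  simp only [Function.iterate_succ_apply']
  exact (hnext _ (hinf j)).1

end F5

namespace F5

open MvPolynomial

/-! ### The invariant of the algorithm -/

section Invariant

variable {n : ℕ} {K : Type*} [Field K] (ord : MonomialOrder (Fin n))

/-- A nonzero homogeneous polynomial. -/
def IsForm (p : MvPolynomial (Fin n) K) : Prop := p ≠ 0 ∧ ∃ e, p.IsHomogeneous e

/-- The data of a critical pair of two elements of the current set `G_i` fit together. -/
def State.PairFits (s : State n K) (p : CritPair n) : Prop :=
  p.r₁ ∈ s.G s.i ∧ p.r₂ ∈ s.G s.i ∧ p.u₁ + s.HM ord p.r₁ = p.t ∧ p.u₂ + s.HM ord p.r₂ = p.t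

/-- The invariant of the algorithm for `m` homogeneous input polynomials. -/
structure Inv (m : ℕ) (s : State n K) : Prop where
  i_le : s.i ≤ m
  le_N : m ≤ s.N
  input : ∀ k < m, IsForm (s.R k).poly
  toDo : ∀ k ∈ s.ToDo, m ≤ k ∧ k < s.N
  mem_G : ∀ j, ∀ k ∈ s.G j, k < s.N ∧ k ∉ s.ToDo ∧ IsForm (s.R k).poly
  -- The last clause makes `G_i` grow strictly when an element of `Done` is added.
  done : ∀ k ∈ s.Done, k < s.N ∧ k ∉ s.ToDo ∧ IsForm (s.R k).poly ∧ k ∉ s.G s.i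
  pairs : ∀ p ∈ s.P, s.PairFits ord p
  selected : s.pc = .spol → ∀ p ∈ s.Pd, s.PairFits ord p
  -- Everything handled in one round has the same degree `d`; hence a reductor from `Done` can only
  -- have multiplier `0`, that is, the monomial 1.
  homogeneous : ∃ d, (s.pc = .spol → ∀ p ∈ s.Pd, p.t.degree = d) ∧
    (s.pc = .spol ∨ s.pc = .reduce → ∀ k ∈ s.ToDo, (s.R k).poly.IsHomogeneous d) ∧
    (s.pc = .reduce → ∀ k ∈ s.Done, (s.R k).poly.IsHomogeneous d)

variable {ord} {m : ℕ} {s s' : State n K}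

theorem Inv.homogeneous_image (h : Inv ord m s) (j : ℕ) :
    ∀ g ∈ (fun k => (s.R k).poly) '' (s.G j : Set ℕ), ∃ e, g.IsHomogeneous e := by
  rintro _ ⟨k, hk, rfl⟩
  exact (h.mem_G j k hk).2.2.2

theorem Inv.isForm_of_mem (h : Inv ord m s) {l : ℕ} (hl : l ∈ s.G s.i ∪ s.Done) :
    l < s.N ∧ l ∉ s.ToDo ∧ IsForm (s.R l).poly := by
  rcases Finset.mem_union.1 hl with hl | hl
  · exact h.mem_G _ l hl
  · exact ⟨(h.done l hl).1, (h.done l hl).2.1, (h.done l hl).2.2.1⟩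

theorem State.fits_of_mem_newPairs {full : Prop} {k : ℕ} {A : Finset ℕ} {p : CritPair n}
    (hp : p ∈ s.newPairs ord full k A) :
    p.r₁ ∈ insert k A ∧ p.r₂ ∈ insert k A ∧ p.u₁ + s.HM ord p.r₁ = p.t ∧
      p.u₂ + s.HM ord p.r₂ = p.t := by
  simp only [State.newPairs, Finset.mem_filter, Finset.mem_image] at hp
  obtain ⟨⟨l, hl, rfl⟩, -⟩ := hp
  have hk : k ∈ insert k A := Finset.mem_insert_self k A
  have hl : l ∈ insert k A := Finset.mem_insert_of_mem hl
  unfold State.mkPair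
  dsimp only
  split_ifs
  · exact ⟨hl, hk, tsub_add_cancel_of_le le_sup_right, tsub_add_cancel_of_le le_sup_left⟩
  · exact ⟨hk, hl, tsub_add_cancel_of_le le_sup_left, tsub_add_cancel_of_le le_sup_right⟩

theorem State.homogeneous_of_inactive (h1 : s.pc ≠ .spol) (h2 : s.pc ≠ .reduce) :
    ∃ d, (s.pc = .spol → ∀ p ∈ s.Pd, p.t.degree = d) ∧
      (s.pc = .spol ∨ s.pc = .reduce → ∀ k ∈ s.ToDo, (s.R k).poly.IsHomogeneous d) ∧
      (s.pc = .reduce → ∀ k ∈ s.Done, (s.R k).poly.IsHomogeneous d) :=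
  ⟨0, fun h => absurd h h1, fun h => h.elim (absurd · h1) (absurd · h2), fun h => absurd h h2⟩

/-- A polynomial of `ToDo` is changed into a homogeneous polynomial of the same degree. -/
theorem Inv.setPoly (h : Inv ord m s) (hpc : s.pc = .reduce) {k : ℕ} (hk : k ∈ s.ToDo)
    {q : MvPolynomial (Fin n) K}
    (hq : ∀ d, (s.R k).poly.IsHomogeneous d → q.IsHomogeneous d) :
    Inv ord m (s.setPoly k q) := by
  have hne : ∀ l, l ∉ s.ToDo → (s.setPoly k q).R l = s.R l := fun l hl =>
    Function.update_of_ne (ne_of_mem_of_not_mem hk hl).symm _ _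
  have hfit : ∀ p, s.PairFits ord p → (s.setPoly k q).PairFits ord p := by
    rintro p ⟨h1, h2, h3, h4⟩
    refine ⟨h1, h2, ?_, ?_⟩
    · rw [State.HM, hne _ (h.mem_G _ _ h1).2.1]; exact h3
    · rw [State.HM, hne _ (h.mem_G _ _ h2).2.1]; exact h4
  constructor
  · exact h.i_le
  · exact h.le_N
  · intro l hl
    rw [hne l fun hl' => absurd (h.toDo l hl').1 (not_le.2 hl)]
    exact h.input l hl
  · exact h.toDo
  · intro j l hl
    rw [hne l (h.mem_G j l hl).2.1]
    exact h.mem_G j l hl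
  · intro l hl
    rw [hne l (h.done l hl).2.1]
    exact h.done l hl
  · exact fun p hp => hfit p (h.pairs p hp)
  · exact fun hs p hp => hfit p (h.selected hs p hp)
  · obtain ⟨d, h1, h2, h3⟩ := h.homogeneous
    refine ⟨d, h1, fun hs l hl => ?_, fun hs l hl => ?_⟩
    · by_cases hlk : l = k
      · subst hlk
        simpa [State.setPoly] using hq d (h2 (.inr hpc) l hk)
      · have : (s.setPoly k q).R l = s.R l := Function.update_of_ne hlk _ _
        rw [this]
        exact h2 hs l hl
    · rw [hne l (h.done l hl).2.1]
      exact h3 hs l hl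

theorem Inv.eraseToDo (h : Inv ord m s) (k : ℕ) :
    Inv ord m { s with ToDo := s.ToDo.erase k } where
  i_le := h.i_le
  le_N := h.le_N
  input := h.input
  toDo l hl := h.toDo l (Finset.mem_of_mem_erase hl)
  mem_G j l hl := ⟨(h.mem_G j l hl).1, fun h' => (h.mem_G j l hl).2.1 (Finset.mem_of_mem_erase h'),
    (h.mem_G j l hl).2.2⟩
  done l hl := ⟨(h.done l hl).1, fun h' => (h.done l hl).2.1 (Finset.mem_of_mem_erase h'),
    (h.done l hl).2.2⟩
  pairs := h.pairs
  selected := h.selected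
  homogeneous := by
    obtain ⟨d, h1, h2, h3⟩ := h.homogeneous
    exact ⟨d, h1, fun hs l hl => h2 hs l (Finset.mem_of_mem_erase hl), h3⟩

theorem Inv.moveDone (h : Inv ord m s) (hpc : s.pc = .reduce) {k : ℕ} (hk : k ∈ s.ToDo)
    (h0 : (s.R k).poly ≠ 0) :
    Inv ord m { s with ToDo := s.ToDo.erase k, Done := insert k s.Done } := by
  have h' := h.eraseToDo k
  obtain ⟨d, h1, h2, h3⟩ := h.homogeneous
  refine ⟨h'.i_le, h'.le_N, h'.input, h'.toDo, h'.mem_G, fun l hl => ?_, h'.pairs, h'.selected,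
    d, h1, fun hs l hl => h2 hs l (Finset.mem_of_mem_erase hl), fun hs l hl => ?_⟩
  · rcases Finset.mem_insert.1 hl with rfl | hl
    · exact ⟨(h.toDo l hk).2, Finset.notMem_erase l _, ⟨h0, d, h2 (.inr hpc) l hk⟩,
        fun hG => (h.mem_G _ l hG).2.1 hk⟩
    · exact h'.done l hl
  · rcases Finset.mem_insert.1 hl with rfl | hl
    · exact h2 (.inr hpc) l hk
    · exact h3 hs l hl

/-- The new polynomial must share the common degree of the round. That degree is not determined by
the state when the sets are empty, so one `d` is required for all conditions together. -/
theorem Inv.generate (h : Inv ord m s) {S : Sig n} {p : MvPolynomial (Fin n) K}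
    (hp : ∃ d, (s.pc = .spol → ∀ p ∈ s.Pd, p.t.degree = d) ∧
      (s.pc = .spol ∨ s.pc = .reduce → ∀ k ∈ s.ToDo, (s.R k).poly.IsHomogeneous d) ∧
      (s.pc = .reduce → ∀ k ∈ s.Done, (s.R k).poly.IsHomogeneous d) ∧ p.IsHomogeneous d) :
    Inv ord m (s.generate S p) := by
  have hne : ∀ l, l < s.N → (s.generate S p).R l = s.R l := fun l hl =>
    Function.update_of_ne hl.ne _ _
  have hToDo : ∀ l, l < s.N → l ∉ s.ToDo → l ∉ (s.generate S p).ToDo := fun l hl hl' h' =>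
    (Finset.mem_insert.1 h').elim hl.ne hl'
  have hfit : ∀ q, s.PairFits ord q → (s.generate S p).PairFits ord q := by
    rintro q ⟨h1, h2, h3, h4⟩
    refine ⟨h1, h2, ?_, ?_⟩
    · rw [State.HM, hne _ (h.mem_G _ _ h1).1]; exact h3
    · rw [State.HM, hne _ (h.mem_G _ _ h2).1]; exact h4
  constructor
  · exact h.i_le
  · exact h.le_N.trans (Nat.le_succ _)
  · intro l hl
    rw [hne l (hl.trans_le h.le_N)]
    exact h.input l hl
  · intro l hl
    rcases Finset.mem_insert.1 hl with rfl | hl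
    · exact ⟨h.le_N, Nat.lt_succ_self _⟩
    · exact ⟨(h.toDo l hl).1, Nat.lt_succ_of_lt (h.toDo l hl).2⟩
  · intro j l hl
    obtain ⟨h1, h2, h3⟩ := h.mem_G j l hl
    rw [hne l h1]
    exact ⟨Nat.lt_succ_of_lt h1, hToDo l h1 h2, h3⟩
  · intro l hl
    obtain ⟨h1, h2, h3⟩ := h.done l hl
    rw [hne l h1]
    exact ⟨Nat.lt_succ_of_lt h1, hToDo l h1 h2, h3⟩
  · exact fun q hq => hfit q (h.pairs q hq)
  · exact fun hs q hq => hfit q (h.selected hs q hq)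
  · obtain ⟨d, h1, h2, h3, hp⟩ := hp
    refine ⟨d, h1, fun hs l hl => ?_, fun hs l hl => ?_⟩
    · rcases Finset.mem_insert.1 hl with rfl | hl
      · simpa [State.generate] using hp
      · rw [hne l (h.toDo l hl).2]
        exact h2 hs l hl
    · rw [hne l (h.done l hl).1]
      exact h3 hs l hl

theorem inv_init {f : Fin m → MvPolynomial (Fin n) K} (hf : ∀ j, f j ≠ 0)
    (hhom : ∀ j, ∃ d, (f j).IsHomogeneous d) : Inv ord m (init ord f) where
  i_le := le_rfl
  le_N := le_rfl
  input k hk := by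
    obtain ⟨e, he⟩ := hhom ⟨k, hk⟩
    simp only [init, hk, dite_true]
    exact ⟨monic_ne_zero (hf _), e, isHomogeneous_monic he⟩
  toDo k hk := absurd hk (Finset.notMem_empty k)
  mem_G j k hk := absurd hk (Finset.notMem_empty k)
  done k hk := absurd hk (Finset.notMem_empty k)
  pairs p hp := absurd hp (Finset.notMem_empty p)
  selected _ p hp := absurd hp (Finset.notMem_empty p)
  homogeneous := ⟨0, fun _ p hp => absurd hp (Finset.notMem_empty p),
    fun _ k hk => absurd hk (Finset.notMem_empty k),
    fun _ k hk => absurd hk (Finset.notMem_empty k)⟩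

theorem Inv.phi_isHomogeneous (h : Inv ord m s) {j d : ℕ} {p q : MvPolynomial (Fin n) K}
    (hφ : s.Phi ord j p q) (hp : p.IsHomogeneous d) : q.IsHomogeneous d :=
  IsNormalForm.isHomogeneous hφ (h.homogeneous_image j) hp

/-- The checks are made after `r_k` was replaced by its normal form `q`; for `l ≠ k` they can be
read off in the state before. -/
theorem IsReductor.add_eq {full : Prop} {k l : ℕ} {q : MvPolynomial (Fin n) K} {u : Fin n →₀ ℕ}
    (hkl : l ≠ k) (hred : (s.setPoly k q).IsReductor ord full k l)
    (hu : u = ord.degree q - s.HM ord l) :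
    u + ord.degree (s.R l).poly = ord.degree q ∧ ¬ s.Rewritten u l := by
  have h1 : (s.setPoly k q).HM ord k = ord.degree q := by simp [State.HM, State.setPoly]
  have h2 : (s.setPoly k q).R l = s.R l := Function.update_of_ne hkl _ _
  have h3 : (s.setPoly k q).HM ord l = s.HM ord l := by rw [State.HM, h2]; rfl
  obtain ⟨ha, -, hc, -⟩ := hred
  rw [h1, h3] at ha hc
  subst hu
  refine ⟨tsub_add_cancel_of_le ha, ?_⟩
  rw [State.Rewritten, State.S, h2] at hc
  exact hc

open Classical in
theorem Step.inv {full : Prop} (hst : Step ord full s s') (h : Inv ord m s) : Inv ord m s' := by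
  cases hst with
  | startCall j hpc hi =>
    have hj : j < m := by have := h.i_le; omega
    have hG : ∀ k ∈ insert j (s.G (j + 1)), k < s.N ∧ k ∉ s.ToDo ∧ IsForm (s.R k).poly := by
      intro k hk
      rcases Finset.mem_insert.1 hk with rfl | hk
      · exact ⟨hj.trans_le h.le_N, fun h' => absurd (h.toDo k h').1 (not_le.2 hj), h.input k hj⟩
      · exact h.mem_G _ k hk
    constructor
    · exact hj.le
    · exact h.le_N
    · exact h.input
    · exact h.toDo
    · intro j' k hk
      simp only [State.startCall] at hk
      by_cases hjj : j' = j
      · subst hjj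
        rw [Function.update_self] at hk
        exact hG k hk
      · rw [Function.update_of_ne hjj] at hk
        exact h.mem_G j' k hk
    · exact fun k hk => absurd hk (Finset.notMem_empty k)
    · intro p hp
      simp only [State.PairFits, State.startCall, Function.update_self]
      have h' := State.fits_of_mem_newPairs (s := { s with pc := .loop, i := j, Done := ∅ }) hp
      exact h'
    · exact nofun
    · exact State.homogeneous_of_inactive nofun nofun
  | endCall hpc hP =>
    exact ⟨h.i_le, h.le_N, h.input, h.toDo, h.mem_G, h.done, h.pairs, nofun,
      State.homogeneous_of_inactive nofun nofun⟩
  | select hpc d hd hmin =>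
    -- The selected degree `d` becomes the common degree of the round.
    refine ⟨h.i_le, h.le_N, h.input, fun k hk => absurd hk (Finset.notMem_empty k), ?_, ?_, ?_, ?_,
      ⟨d, ?_, fun _ k hk => absurd hk (Finset.notMem_empty k), nofun⟩⟩
    · exact fun j k hk => ⟨(h.mem_G j k hk).1, Finset.notMem_empty k, (h.mem_G j k hk).2.2⟩
    · exact fun k hk => ⟨(h.done k hk).1, Finset.notMem_empty k, (h.done k hk).2.2⟩
    · exact fun p hp => h.pairs p (Finset.mem_filter.1 hp).1
    · exact fun _ p hp => h.pairs p (Finset.mem_filter.1 hp).1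
    · exact fun _ p hp => (Finset.mem_filter.1 hp).2
  | spolSkip hpc p hp hrw =>
    obtain ⟨d, h1, h2, h3⟩ := h.homogeneous
    exact ⟨h.i_le, h.le_N, h.input, h.toDo, h.mem_G, h.done, h.pairs,
      fun hs q hq => h.selected hs q (Finset.mem_of_mem_erase hq),
      d, fun hs q hq => h1 hs q (Finset.mem_of_mem_erase hq), h2, h3⟩
  | spolMake hpc p hp hrw₁ hrw₂ =>
    obtain ⟨d, h1, h2, h3⟩ := h.homogeneous
    have h' : Inv ord m { s with Pd := s.Pd.erase p } :=
      ⟨h.i_le, h.le_N, h.input, h.toDo, h.mem_G, h.done, h.pairs,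
        fun hs q hq => h.selected hs q (Finset.mem_of_mem_erase hq),
        d, fun hs q hq => h1 hs q (Finset.mem_of_mem_erase hq), h2, h3⟩
    obtain ⟨ha, hb, hc, hd⟩ := h.selected hpc p hp
    obtain ⟨-, -, ha0, e, ha⟩ := h.mem_G _ _ ha
    obtain ⟨-, -, hb0, e', hb⟩ := h.mem_G _ _ hb
    have hS := isHomogeneous_spoly ha0 hb0 hc hd ha hb
    rw [h1 hpc p hp] at hS
    exact h'.generate ⟨d, fun hs q hq => h1 hs q (Finset.mem_of_mem_erase hq), h2, h3, hS⟩
  | spolEnd hpc hPd =>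
    obtain ⟨d, h1, h2, h3⟩ := h.homogeneous
    exact ⟨h.i_le, h.le_N, h.input, h.toDo, h.mem_G, fun k hk => absurd hk (Finset.notMem_empty k),
      h.pairs, nofun, d, nofun, fun _ => h2 (.inl hpc),
      fun _ k hk => absurd hk (Finset.notMem_empty k)⟩
  | reduceZero hpc k hk hφ =>
    exact (h.setPoly hpc hk.1 fun d _ => isHomogeneous_zero _ _ d).eraseToDo k
  | reduceDone hpc k hk q hφ hq hred =>
    exact (h.setPoly hpc hk.1 fun d hd => isHomogeneous_monic (h.phi_isHomogeneous hφ hd)).moveDone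
      hpc hk.1 (by simpa [State.setPoly] using monic_ne_zero hq)
  | reduceSafe hpc k hk q hφ hq l hl hred u hu hsig =>
    obtain ⟨-, hl1, hl2, e, hl3⟩ := h.isForm_of_mem hl
    have hkl : l ≠ k := fun e => hl1 (e ▸ hk.1)
    exact h.setPoly hpc hk.1 fun d hd => isHomogeneous_topReduce hq hl2
      (IsReductor.add_eq hkl hred hu).1 _ (h.phi_isHomogeneous hφ hd) hl3
  | reduceUnsafe hpc k hk q hφ hq l hl hred u hu hsig =>
    obtain ⟨-, hl1, hl2, e, hl3⟩ := h.isForm_of_mem hl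
    have hkl : l ≠ k := fun e => hl1 (e ▸ hk.1)
    have h' := h.setPoly hpc hk.1 fun d hd => h.phi_isHomogeneous hφ hd
    obtain ⟨d, h1, h2, h3⟩ := h'.homogeneous
    refine h'.generate ⟨d, h1, h2, h3, ?_⟩
    have hqd : q.IsHomogeneous d := by
      simpa [State.setPoly] using h2 (.inr hpc) k hk.1
    -- The S-polynomial has the degree of `u · HM(r_l) = HM(q)`, which is `d`.
    rw [← degree_degree_of_isHomogeneous (ord := ord) hqd hq]
    exact isHomogeneous_spoly hl2 hq (IsReductor.add_eq hkl hred hu).1 (zero_add _) hl3 hqd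
  | reduceEnd hpc hT =>
    exact ⟨h.i_le, h.le_N, h.input, h.toDo, h.mem_G, h.done, h.pairs, nofun,
      State.homogeneous_of_inactive nofun nofun⟩
  | updateAdd hpc k hk =>
    have hG : s.G s.i ⊆ insert k (s.G s.i) := Finset.subset_insert _ _
    refine ⟨h.i_le, h.le_N, h.input, h.toDo, ?_, ?_, ?_, fun hs => ?_,
      State.homogeneous_of_inactive ?_ ?_⟩
    · intro j l hl
      dsimp only at hl
      by_cases hj : j = s.i
      · subst hj
        rw [Function.update_self] at hl
        rcases Finset.mem_insert.1 hl with rfl | hl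
        · exact ⟨(h.done l hk).1, (h.done l hk).2.1, (h.done l hk).2.2.1⟩
        · exact h.mem_G _ l hl
      · rw [Function.update_of_ne hj] at hl
        exact h.mem_G _ l hl
    · intro l hl
      obtain ⟨hlk, hl⟩ := Finset.mem_erase.1 hl
      obtain ⟨h1, h2, h3, h4⟩ := h.done l hl
      refine ⟨h1, h2, h3, ?_⟩
      dsimp only
      rw [Function.update_self]
      exact fun h' => (Finset.mem_insert.1 h').elim hlk h4
    · intro p hp
      simp only [State.PairFits, Function.update_self]
      rcases Finset.mem_union.1 hp with hp | hp
      · obtain ⟨h1, h2, h3⟩ := h.pairs p hp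
        exact ⟨hG h1, hG h2, h3⟩
      · have h' := State.fits_of_mem_newPairs hp
        exact h'
    · exact nomatch hpc.symm.trans hs
    · exact fun hs => nomatch hpc.symm.trans hs
    · exact fun hs => nomatch hpc.symm.trans hs
  | updateEnd hpc hD =>
    exact ⟨h.i_le, h.le_N, h.input, h.toDo, h.mem_G, h.done, h.pairs, nofun,
      State.homogeneous_of_inactive nofun nofun⟩

end Invariant

end F5

namespace F5

open MvPolynomial

/-! ### What a step changes, and how polynomials are generated -/

section Steps

variable {n : ℕ} {K : Type*} [Field K] (ord : MonomialOrder (Fin n))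

/-- The passage from `s` to a later state `s'`: signatures are kept, polynomials outside `ToDo` are
not changed any more, head monomials do not grow, and only rules of new polynomials are added. -/
structure Tracks (s s' : State n K) : Prop where
  N_le : s.N ≤ s'.N
  sig : ∀ k < s.N, (s'.R k).sig = (s.R k).sig
  frozen : ∀ k < s.N, k ∉ s.ToDo → s'.R k = s.R k ∧ k ∉ s'.ToDo
  headDegree_le : ∀ k < s.N, headDegree ord (s'.R k).poly ≤ headDegree ord (s.R k).poly
  rules : ∀ j, ∃ L, s'.Rule j = L ++ s.Rule j ∧ ∀ r ∈ L, s.N ≤ r.2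

/-- The passage from `s` to `s'` generates a labeled polynomial from the part `u · r_l`. -/
structure Generates (s s' : State n K) (l : ℕ) (u : Fin n →₀ ℕ) : Prop where
  N_eq : s'.N = s.N + 1
  mem : l ∈ s.G s.i ∨ (s.pc = .reduce ∧ l ∈ s.Done ∧ u = 0)
  not_rewritten : ¬ s.Rewritten u l
  sig : (s'.R s.N).sig = Sig.mul u (s.R l).sig
  rule : ∃ L, s'.Rule (s.R l).sig.idx = (u + (s.R l).sig.mono, s.N) :: L
  headDegree_lt : headDegree ord (s'.R s.N).poly < ord.toSyn (u + ord.degree (s.R l).poly)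

variable {ord} {m : ℕ} {s s' s'' : State n K} {full : Prop}

theorem Tracks.trans (h : Tracks ord s s') (h' : Tracks ord s' s'') : Tracks ord s s'' where
  N_le := h.N_le.trans h'.N_le
  sig k hk := (h'.sig k (hk.trans_le h.N_le)).trans (h.sig k hk)
  frozen k hk hk' := by
    obtain ⟨h1, h2⟩ := h.frozen k hk hk'
    obtain ⟨h3, h4⟩ := h'.frozen k (hk.trans_le h.N_le) h2
    exact ⟨h3.trans h1, h4⟩
  headDegree_le k hk := (h'.headDegree_le k (hk.trans_le h.N_le)).trans (h.headDegree_le k hk)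
  rules j := by
    obtain ⟨L, h1, h2⟩ := h.rules j
    obtain ⟨L', h3, h4⟩ := h'.rules j
    refine ⟨L' ++ L, by rw [h3, h1, List.append_assoc], fun r hr => ?_⟩
    rcases List.mem_append.1 hr with hr | hr
    · exact h.N_le.trans (h4 r hr)
    · exact h2 r hr

theorem Tracks.of_eq (hN : s'.N = s.N) (hR : s'.R = s.R) (hRule : s'.Rule = s.Rule)
    (hT : s'.ToDo ⊆ s.ToDo) : Tracks ord s s' where
  N_le := hN.ge
  sig k _ := by rw [hR]
  frozen k _ hk := ⟨by rw [hR], fun h => hk (hT h)⟩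
  headDegree_le k _ := by rw [hR]
  rules j := ⟨[], by rw [hRule, List.nil_append], nofun⟩

theorem Tracks.setPoly {k : ℕ} (hk : k ∈ s.ToDo) {q : MvPolynomial (Fin n) K}
    (hq : headDegree ord q ≤ headDegree ord (s.R k).poly) : Tracks ord s (s.setPoly k q) where
  N_le := le_rfl
  sig l _ := by
    by_cases h : l = k
    · subst h; simp [State.setPoly, State.S]
    · simp [State.setPoly, Function.update_of_ne h]
  frozen l _ hl :=
    ⟨Function.update_of_ne (ne_of_mem_of_not_mem hk hl).symm _ _, hl⟩
  headDegree_le l _ := by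
    by_cases h : l = k
    · subst h; simpa [State.setPoly] using hq
    · simp [State.setPoly, Function.update_of_ne h]
  rules j := ⟨[], rfl, nofun⟩

theorem Tracks.generate (S : Sig n) (p : MvPolynomial (Fin n) K) :
    Tracks ord s (s.generate S p) where
  N_le := Nat.le_succ _
  sig l hl := by simp [State.generate, Function.update_of_ne hl.ne]
  frozen l hl hl' := ⟨Function.update_of_ne hl.ne _ _,
    fun h => (Finset.mem_insert.1 h).elim hl.ne hl'⟩
  headDegree_le l hl := by simp [State.generate, Function.update_of_ne hl.ne]
  rules j := by
    by_cases hj : j = S.idx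
    · subst hj
      exact ⟨[(S.mono, s.N)], by simp [State.generate], by simp⟩
    · exact ⟨[], by simp [State.generate, Function.update_of_ne hj], nofun⟩

open Classical in
theorem Step.tracks (hst : Step ord full s s') (h : Inv ord m s) : Tracks ord s s' := by
  cases hst with
  | startCall j hpc hi => exact .of_eq rfl rfl rfl subset_rfl
  | endCall hpc hP => exact .of_eq rfl rfl rfl subset_rfl
  | select hpc d hd hmin => exact .of_eq rfl rfl rfl (Finset.empty_subset _)
  | spolSkip hpc p hp hrw => exact .of_eq rfl rfl rfl subset_rfl
  | spolMake hpc p hp hrw₁ hrw₂ =>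
    exact Tracks.trans (s' := { s with Pd := s.Pd.erase p }) (.of_eq rfl rfl rfl subset_rfl)
      (.generate _ _)
  | spolEnd hpc hPd => exact .of_eq rfl rfl rfl subset_rfl
  | reduceZero hpc k hk hφ =>
    exact (Tracks.setPoly hk.1 (headDegree_zero.trans_le bot_le)).trans
      (.of_eq rfl rfl rfl (Finset.erase_subset _ _))
  | reduceDone hpc k hk q hφ hq hred =>
    exact (Tracks.setPoly hk.1 ((headDegree_monic hq).trans_le hφ.headDegree_le)).trans
      (.of_eq rfl rfl rfl (Finset.erase_subset _ _))
  | reduceSafe hpc k hk q hφ hq l hl hred u hu hsig =>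
    obtain ⟨-, hl1, hl2, -⟩ := h.isForm_of_mem hl
    exact Tracks.setPoly hk.1 ((headDegree_topReduce_lt hq hl2
      (IsReductor.add_eq (ne_of_mem_of_not_mem hk.1 hl1).symm hred hu).1).le.trans
      hφ.headDegree_le)
  | reduceUnsafe hpc k hk q hφ hq l hl hred u hu hsig =>
    exact (Tracks.setPoly hk.1 hφ.headDegree_le).trans (.generate _ _)
  | reduceEnd hpc hT => exact .of_eq rfl rfl rfl subset_rfl
  | updateAdd hpc k hk => exact .of_eq rfl rfl rfl subset_rfl
  | updateEnd hpc hD => exact .of_eq rfl rfl rfl subset_rfl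

open Classical in
theorem Step.i_le (hst : Step ord full s s') : s'.i ≤ s.i := by
  cases hst with
  | startCall j hpc hi => exact (Nat.le_succ j).trans hi.ge
  | _ => exact le_rfl

open Classical in
theorem Step.G_subset (hst : Step ord full s s') (hi : s'.i = s.i) : s.G s.i ⊆ s'.G s.i := by
  cases hst with
  | startCall j hpc hi' => exact absurd (hi.trans hi') (Nat.ne_of_lt (Nat.lt_succ_self j))
  | updateAdd hpc k hk =>
    dsimp only
    rw [Function.update_self]
    exact Finset.subset_insert _ _
  | _ => exact subset_rfl

/-- Elements of `Done` stay there until they are added to `G_i`. -/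
theorem Step.mem_done_or (hst : Step ord full s s') {k : ℕ} (hk : k ∈ s.Done)
    (hpc : s.pc = .reduce ∨ s.pc = .update) :
    (k ∈ s'.G s'.i) ∨ k ∈ s'.Done ∧ (s'.pc = .reduce ∨ s'.pc = .update) := by
  classical
  cases hst with
  | reduceDone hpc k hk q hφ hq hred => exact .inr ⟨Finset.mem_insert_of_mem ‹_›, .inl hpc⟩
  | reduceEnd hpc hT => exact .inr ⟨hk, .inr rfl⟩
  | updateAdd hpc' l hl =>
    by_cases hkl : k = l
    · left
      simp [hkl]
    · exact .inr ⟨Finset.mem_erase.2 ⟨hkl, hk⟩, hpc⟩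
  | updateEnd hpc' hD => simp [hD] at hk
  | reduceZero | reduceSafe | reduceUnsafe => exact .inr ⟨hk, hpc⟩
  | _ => simp_all

open Classical in
theorem Step.reduce_eq (hst : Step ord full s s') (hpc : s.pc = .reduce) :
    s'.i = s.i ∧ s'.G = s.G := by
  cases hst with
  | startCall | updateAdd => simp_all
  | _ => exact ⟨rfl, rfl⟩

open Classical in
-- The loop over `Done` generates nothing and cannot be left before `Done` is empty, so an infinite
-- run cannot keep an element there in this phase.
theorem Step.update_eq (hst : Step ord full s s') (hpc : s.pc = .update) {k : ℕ}
    (hk : k ∈ s.Done) : s'.pc = .update ∧ s'.N = s.N := by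
  cases hst with
  | updateAdd => exact ⟨hpc, rfl⟩
  | _ => simp_all

theorem Generates.lt_N {l : ℕ} {u : Fin n →₀ ℕ} (hg : Generates ord s s' l u) (h : Inv ord m s) :
    l < s.N ∧ l ∉ s.ToDo ∧ IsForm (s.R l).poly :=
  h.isForm_of_mem (Finset.mem_union.2 (hg.mem.imp_right fun h => h.2.1))

/-- After `u · r_l` was used to generate a polynomial, all its multiples are rewritten. -/
theorem Generates.rewritten {l : ℕ} {u u' : Fin n →₀ ℕ} (hg : Generates ord s s' l u)
    (hl : l < s.N) (ht : Tracks ord s s') (ht' : Tracks ord s' s'') (hu : u ≤ u') :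
    s''.Rewritten u' l := by
  have hsig : (s''.R l).sig = (s.R l).sig := (ht.trans ht').sig l hl
  obtain ⟨L, hL⟩ := hg.rule
  obtain ⟨L', hL', hN⟩ := ht'.rules (s.R l).sig.idx
  rw [hL] at hL'
  unfold State.Rewritten State.S
  rw [hsig, hL', List.find?_append]
  set p : (Fin n →₀ ℕ) × ℕ → Bool := fun r => decide (r.1 ≤ u' + (s.R l).sig.mono)
  -- The newest rule dividing the signature is either a later one, whose position exceeds `s.N`, or
  -- the rule of position `s.N` itself. Both positions differ from `l < s.N`.
  cases hf : L'.find? p with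
  | some r =>
    have h1 := hN r (List.mem_of_find?_eq_some hf)
    rw [hg.N_eq] at h1
    exact ⟨r, by simp, by omega⟩
  | none =>
    refine ⟨(u + (s.R l).sig.mono, s.N), ?_, hl.ne'⟩
    rw [List.find?_cons_of_pos (by simpa [p] using hu)]
    rfl

/-- The parent is the part that supplies the signature: the first part of the pair in `Spol`, the
reductor in `Reduction`. -/
theorem Step.generates (hst : Step ord full s s') (h : Inv ord m s) :
    s'.N = s.N ∨ ∃ l u, Generates ord s s' l u := by
  classical
  cases hst with
  | spolMake hpc p hp hrw₁ hrw₂ =>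
    right
    obtain ⟨ha, hb, hc, hd⟩ := h.selected hpc p hp
    have ha' := (h.mem_G _ _ ha).2.2.1
    have hb' := (h.mem_G _ _ hb).2.2.1
    refine ⟨p.r₁, p.u₁, rfl, .inl ha, hrw₁, ?_, ?_, ?_⟩
    · simp [State.generate, State.S]
    · simp [State.generate, State.S, Sig.mul]
    · have h1 := headDegree_spoly_lt ha' hb' hc hd
      rw [← hc] at h1
      simpa [State.generate, State.HM] using h1
  | reduceUnsafe hpc k hk q hφ hq l hl hred u hu hsig =>
    right
    obtain ⟨hlN, hl1, hl2, e, hl3⟩ := h.isForm_of_mem hl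
    have hkl : l ≠ k := fun e => hl1 (e ▸ hk.1)
    obtain ⟨hadd, hrw⟩ := IsReductor.add_eq hkl hred hu
    refine ⟨l, u, rfl, ?_, hrw, ?_, ?_, ?_⟩
    · refine (Finset.mem_union.1 hl).imp_right fun hl => ⟨hpc, hl, ?_⟩
      -- Both `q` and `r_l` have degree `d`, so `u · HM(r_l) = HM(q)` leaves degree 0 for `u`.
      obtain ⟨d, -, h2, h3⟩ := h.homogeneous
      have h4 := degree_degree_of_isHomogeneous (ord := ord)
        (h.phi_isHomogeneous hφ (h2 (.inr hpc) k hk.1)) hq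
      rw [← hadd, map_add, degree_degree_of_isHomogeneous (h3 hpc l hl) hl2] at h4
      exact (Finsupp.degree_eq_zero_iff u).1 (by omega)
    · simp [State.generate, State.S, State.setPoly]
    · simp [State.generate, State.S, Sig.mul, State.setPoly]
    · have h1 := headDegree_spoly_lt hl2 hq hadd (zero_add _)
      rw [← hadd] at h1
      simpa [State.generate, State.setPoly] using h1
  | _ => exact .inl rfl

end Steps

/-! ### A well-founded measure for steps that generate nothing -/

section Termination

variable {n : ℕ} {K : Type*} [Field K] (ord : MonomialOrder (Fin n))

/-- A number for each program point that decreases within one round of the loop. -/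
def Phase.rank : Phase → ℕ
  | .call => 0
  | .loop => 1
  | .update => 2
  | .reduce => 3
  | .spol => 4

/-- A measure which decreases in every step that generates no polynomial. -/
noncomputable def State.measure (B : ℕ) (s : State n K) :
    ℕ ×ₗ ℕ ×ₗ ℕ ×ₗ ℕ ×ₗ ℕ ×ₗ ℕ ×ₗ (Fin B → WithBot ord.syn) :=
  toLex (s.i, toLex (s.N - (s.G s.i).card, toLex (s.P.card, toLex (s.pc.rank,
    toLex (s.Pd.card, toLex (s.ToDo.card, fun k => headDegree ord (s.R k).poly))))))

theorem lex_lt_left {α β : Type*} [Preorder α] [Preorder β] {a a' : α} {b b' : β} (h : a < a') :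
    toLex (a, b) < toLex (a', b') := Prod.Lex.left _ _ h

theorem lex_lt_right {α β : Type*} [Preorder α] [Preorder β] {a a' : α} {b b' : β} (ha : a = a')
    (h : b < b') : toLex (a, b) < toLex (a', b') := ha ▸ Prod.Lex.right _ h

variable {ord} {m : ℕ} {s s' : State n K} {full : Prop}

theorem Step.measure_lt (hst : Step ord full s s') (h : Inv ord m s) (hN : s'.N = s.N) :
    s'.measure ord s.N < s.measure ord s.N := by
  classical
  cases hst with
  | startCall j hpc hi => exact lex_lt_left (hi ▸ Nat.lt_succ_self j)
  | endCall hpc hP =>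
    refine lex_lt_right rfl (lex_lt_right rfl (lex_lt_right rfl (lex_lt_left ?_)))
    simp [hpc, Phase.rank]
  | select hpc d hd hmin =>
    obtain ⟨p, hp, hd⟩ := hd
    exact lex_lt_right rfl (lex_lt_right rfl (lex_lt_left (Finset.card_lt_card
      (Finset.filter_ssubset.2 ⟨p, hp, not_not.2 hd⟩))))
  | spolSkip hpc p hp hrw =>
    exact lex_lt_right rfl (lex_lt_right rfl (lex_lt_right rfl (lex_lt_right rfl
      (lex_lt_left (Finset.card_erase_lt_of_mem hp)))))
  | spolMake hpc p hp hrw₁ hrw₂ => exact absurd hN (Nat.succ_ne_self _)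
  | spolEnd hpc hPd =>
    refine lex_lt_right rfl (lex_lt_right rfl (lex_lt_right rfl (lex_lt_left ?_)))
    simp [hpc, Phase.rank]
  | reduceZero hpc k hk hφ =>
    exact lex_lt_right rfl (lex_lt_right rfl (lex_lt_right rfl (lex_lt_right rfl
      (lex_lt_right rfl (lex_lt_left (Finset.card_erase_lt_of_mem hk.1))))))
  | reduceDone hpc k hk q hφ hq hred =>
    exact lex_lt_right rfl (lex_lt_right rfl (lex_lt_right rfl (lex_lt_right rfl
      (lex_lt_right rfl (lex_lt_left (Finset.card_erase_lt_of_mem hk.1))))))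
  | reduceSafe hpc k hk q hφ hq l hl hred u hu hsig =>
    obtain ⟨hlN, hl1, hl2, -⟩ := h.isForm_of_mem hl
    have hkl : l ≠ k := fun e => hl1 (e ▸ hk.1)
    have hlt := (headDegree_topReduce_lt hq hl2 (IsReductor.add_eq hkl hred hu).1).trans_le
      hφ.headDegree_le
    refine lex_lt_right rfl (lex_lt_right rfl (lex_lt_right rfl (lex_lt_right rfl
      (lex_lt_right rfl (lex_lt_right rfl ?_)))))
    -- In the componentwise order no head monomial grows, and that of `r_k` drops.
    refine Pi.lt_def.2 ⟨fun l' => (Tracks.setPoly hk.1 hlt.le).headDegree_le l' l'.2,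
      ⟨k, (h.toDo k hk.1).2⟩, ?_⟩
    simpa [State.setPoly] using hlt
  | reduceUnsafe hpc k hk q hφ hq l hl hred u hu hsig => exact absurd hN (Nat.succ_ne_self _)
  | reduceEnd hpc hT =>
    refine lex_lt_right rfl (lex_lt_right rfl (lex_lt_right rfl (lex_lt_left ?_)))
    simp [hpc, Phase.rank]
  | updateAdd hpc k hk =>
    obtain ⟨h1, -, -, h4⟩ := h.done k hk
    refine lex_lt_right rfl (lex_lt_left ?_)
    -- The enlarged `G_i` still consists of positions below `N`, so the truncated subtraction really
    -- drops.
    have hsub : insert k (s.G s.i) ⊆ Finset.range s.N := by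
      intro l hl
      rcases Finset.mem_insert.1 hl with rfl | hl
      · exact Finset.mem_range.2 h1
      · exact Finset.mem_range.2 (h.mem_G _ l hl).1
    have hcard := Finset.card_le_card hsub
    rw [Finset.card_range] at hcard
    simp only [Function.update_self]
    rw [Finset.card_insert_of_notMem h4] at hcard ⊢
    omega
  | updateEnd hpc hD =>
    refine lex_lt_right rfl (lex_lt_right rfl (lex_lt_right rfl (lex_lt_left ?_)))
    simp [hpc, Phase.rank]

theorem not_strictAnti_of_wellFoundedLT {α : Type*} [Preorder α] [WellFoundedLT α] (g : ℕ → α)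
    (T : ℕ) : ¬ ∀ t, T ≤ t → g (t + 1) < g t := fun h =>
  (RelEmbedding.natGT (r := (· < ·)) (fun t => g (T + t))
    fun t => h _ (Nat.le_add_right T t)).not_wellFounded wellFounded_lt

end Termination

end F5

namespace F5

open MvPolynomial

/-! ### Infinite runs and chains of descendants -/

section Runs

variable {n m : ℕ} {K : Type*} [Field K] {ord : MonomialOrder (Fin n)} {full : Prop}
  {run : ℕ → State n K}

theorem tracks_of_le (hstep : ∀ t, Step ord full (run t) (run (t + 1)))
    (hinv : ∀ t, Inv ord m (run t)) {t t' : ℕ} (h : t ≤ t') : Tracks ord (run t) (run t') := by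
  induction t', h using Nat.le_induction with
  | base => exact .of_eq rfl rfl rfl subset_rfl
  | succ t' _ ih => exact ih.trans ((hstep t').tracks (hinv t'))

/-- An infinite run generates infinitely many labeled polynomials. -/
theorem exists_lt_N (hstep : ∀ t, Step ord full (run t) (run (t + 1)))
    (hinv : ∀ t, Inv ord m (run t)) (B : ℕ) : ∃ t, B < (run t).N := by
  by_contra! hB
  have hbdd : BddAbove (Set.range fun t => (run t).N) := ⟨B, by rintro _ ⟨t, rfl⟩; exact hB t⟩
  -- Once `N` attains its maximum, no later step generates and the measure would decrease forever.
  obtain ⟨T, hT⟩ := Nat.sSup_mem (Set.range_nonempty fun t => (run t).N) hbdd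
  have hN : ∀ t, T ≤ t → (run t).N = (run T).N := fun t ht => by
    refine le_antisymm ?_ (tracks_of_le hstep hinv ht).N_le
    exact (le_csSup hbdd ⟨t, rfl⟩).trans hT.ge
  refine not_strictAnti_of_wellFoundedLT (fun t => (run t).measure ord (run T).N) T fun t ht => ?_
  have h1 := (hstep t).measure_lt (hinv t) (by rw [hN _ ht, hN _ (ht.trans t.le_succ)])
  rwa [hN t ht] at h1

/-- Since `N` starts at `m` and grows by at most one per step, position `k` is filled in the step
that first brings `N` above `k`. -/
theorem exists_generates (hstep : ∀ t, Step ord full (run t) (run (t + 1)))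
    (hinv : ∀ t, Inv ord m (run t)) (h0 : (run 0).N = m) {k : ℕ} (hk : m ≤ k) :
    ∃ t l u, (run t).N = k ∧ Generates ord (run t) (run (t + 1)) l u := by
  classical
  have hex := exists_lt_N hstep hinv k
  obtain ⟨t, ht⟩ : ∃ t, Nat.find hex = t + 1 := by
    refine Nat.exists_eq_succ_of_ne_zero fun h => ?_
    have := Nat.find_spec hex
    rw [h] at this
    omega
  have h1 : k < (run (t + 1)).N := ht ▸ Nat.find_spec hex
  have h2 : (run t).N ≤ k := not_lt.1 (Nat.find_min hex (by omega))
  rcases (hstep t).generates (hinv t) with h | ⟨l, u, h⟩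
  · omega
  · exact ⟨t, l, u, by have := h.N_eq; omega, h⟩

/-- An infinite chain of labeled polynomials, each of which is generated from a multiple of its
predecessor; `r_{c (j + 1)}` is generated from `u j · r_{c j}` at the time `σ j`. -/
structure Chain (ord : MonomialOrder (Fin n)) (run : ℕ → State n K) (c σ : ℕ → ℕ)
    (u : ℕ → Fin n →₀ ℕ) : Prop where
  c_lt (j) : c j < c (j + 1)
  σ_lt (j) : σ j < σ (j + 1)
  N_eq (j) : (run (σ j)).N = c (j + 1)
  notMem_toDo (j) : c j ∉ (run (σ j)).ToDo
  poly_ne_zero (j) : ((run (σ j)).R (c j)).poly ≠ 0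
  mem (j) : c j ∈ (run (σ j)).G (run (σ j)).i ∨
    (run (σ j)).pc = .reduce ∧ c j ∈ (run (σ j)).Done ∧ u j = 0
  sig (j) : (run (σ (j + 1))).S (c (j + 1)) = Sig.mul (u j) ((run (σ j)).S (c j))
  HM_lt (j) : ord.toSyn ((run (σ (j + 1))).HM ord (c (j + 1))) <
    ord.toSyn (u j + (run (σ j)).HM ord (c j))

theorem exists_chain (hstep : ∀ t, Step ord full (run t) (run (t + 1)))
    (hinv : ∀ t, Inv ord m (run t)) (h0 : (run 0).N = m) : ∃ c σ u, Chain ord run c σ u := by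
  have hgen : ∀ k, m ≤ k → ∃ t l u, (run t).N = k ∧ Generates ord (run t) (run (t + 1)) l u :=
    fun k hk => exists_generates hstep hinv h0 hk
  choose! τ par mul hN hgen using hgen
  have hτ : ∀ k k', m ≤ k → k < k' → τ k < τ k' := by
    intro k k' hk hkk'
    by_contra! h
    have := (tracks_of_le hstep hinv h).N_le
    rw [hN k hk, hN k' (hk.trans hkk'.le)] at this
    omega
  have hlt : ∀ k, m ≤ k → par k < k := fun k hk => by
    have := ((hgen k hk).lt_N (hinv _)).1
    rwa [hN k hk] at this
  have hfin : ∀ l, {k | m ≤ k ∧ par k = l}.Finite := by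
    intro l
    by_contra hinf
    have hmem := Nat.nth_mem_of_infinite hinf
    -- Dickson's lemma: among infinitely many children of `l`, an earlier multiplier divides a later
    -- one, so the later part was already rewritten when it was used.
    obtain ⟨a, b, hab, hle⟩ := wellQuasiOrdered_le fun j =>
      mul (Nat.nth (fun k => m ≤ k ∧ par k = l) j)
    have hkk := Nat.nth_strictMono hinf hab
    obtain ⟨ha, hal⟩ := hmem a
    obtain ⟨hb, hbl⟩ := hmem b
    generalize Nat.nth (fun k => m ≤ k ∧ par k = l) a = k at *
    generalize Nat.nth (fun k => m ≤ k ∧ par k = l) b = k' at *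
    refine (hgen k' hb).not_rewritten ?_
    rw [hbl, ← hal]
    exact (hgen k ha).rewritten ((hgen k ha).lt_N (hinv _)).1 ((hstep _).tracks (hinv _))
      (tracks_of_le hstep hinv (hτ k k' ha hkk)) hle
  obtain ⟨c, hc⟩ := exists_chain_of_finite_fibers par hlt hfin
  have hm : ∀ j, m ≤ c (j + 1) := fun j => (hc j).1
  have hg : ∀ j, Generates ord (run (τ (c (j + 1)))) (run (τ (c (j + 1)) + 1)) (c j)
      (mul (c (j + 1))) := fun j => by
    have := hgen _ (hm j)
    rwa [(hc j).2] at this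
  have hclt : ∀ j, c j < c (j + 1) := fun j => by
    have := hlt _ (hm j)
    rwa [(hc j).2] at this
  have hτlt : ∀ j, τ (c (j + 1)) < τ (c (j + 1 + 1)) := fun j => hτ _ _ (hm j) (hclt _)
  have htr : ∀ j, Tracks ord (run (τ (c (j + 1)) + 1)) (run (τ (c (j + 1 + 1)))) := fun j =>
    tracks_of_le hstep hinv (hτlt j)
  have hN' : ∀ j, c (j + 1) < (run (τ (c (j + 1)) + 1)).N := fun j => by
    rw [(hg j).N_eq, hN _ (hm j)]
    exact Nat.lt_succ_self _
  refine ⟨c, fun j => τ (c (j + 1)), fun j => mul (c (j + 1)), hclt, hτlt, fun j => hN _ (hm j),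
    fun j => ((hg j).lt_N (hinv _)).2.1, fun j => ((hg j).lt_N (hinv _)).2.2.1,
    fun j => (hg j).mem, fun j => ?_, fun j => ?_⟩
  · have h1 := (hg j).sig
    rw [hN _ (hm j)] at h1
    exact ((htr j).sig _ (hN' j)).trans h1
  -- Between its generation and its use as parent the polynomial may be reduced, which can only
  -- lower its head monomial.
  · have h1 := (hg j).headDegree_lt
    rw [hN _ (hm j)] at h1
    have h2 := ((htr j).headDegree_le _ (hN' j)).trans_lt h1
    rw [headDegree_eq_coe ((hg (j + 1)).lt_N (hinv _)).2.2.1] at h2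
    exact WithBot.coe_lt_coe.1 h2

theorem Chain.R_eq {c σ : ℕ → ℕ} {u : ℕ → Fin n →₀ ℕ} (hc : Chain ord run c σ u)
    (hstep : ∀ t, Step ord full (run t) (run (t + 1))) (hinv : ∀ t, Inv ord m (run t))
    {j t : ℕ} (ht : σ j ≤ t) : (run t).R (c j) = (run (σ j)).R (c j) :=
  ((tracks_of_le hstep hinv ht).frozen _ (hc.N_eq j ▸ hc.c_lt j) (hc.notMem_toDo j)).1

/-- Multipliers compose along the chain, and the strict inequalities survive multiplication by
monomials. -/
theorem Chain.exists_mul {c σ : ℕ → ℕ} {u : ℕ → Fin n →₀ ℕ} (hc : Chain ord run c σ u)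
    {a b : ℕ} (hab : a + 1 ≤ b) :
    ∃ v, (run (σ b)).S (c b) = Sig.mul v ((run (σ a)).S (c a)) ∧
      ord.toSyn ((run (σ b)).HM ord (c b)) < ord.toSyn (v + (run (σ a)).HM ord (c a)) := by
  induction b, hab using Nat.le_induction with
  | base => exact ⟨u a, hc.sig a, hc.HM_lt a⟩
  | succ b _ ih =>
    obtain ⟨v, h1, h2⟩ := ih
    refine ⟨u b + v, ?_, (hc.HM_lt b).trans ?_⟩
    · rw [hc.sig b, h1]
      simp [Sig.mul, add_assoc]
    · rw [add_assoc, map_add, map_add]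
      gcongr

theorem mem_G_of_le (hstep : ∀ t, Step ord full (run t) (run (t + 1))) {T k : ℕ}
    (hi : ∀ t, T ≤ t → (run t).i = (run T).i) {t₁ t : ℕ} (h₁ : T ≤ t₁) (ht : t₁ ≤ t)
    (hk : k ∈ (run t₁).G (run t₁).i) : k ∈ (run t).G (run t).i := by
  induction t, ht using Nat.le_induction with
  | base => exact hk
  | succ t ht ih =>
    have hi' : (run (t + 1)).i = (run t).i := by
      rw [hi t (h₁.trans ht), hi (t + 1) (h₁.trans (ht.trans t.le_succ))]
    rw [hi']
    exact (hstep t).G_subset hi' ih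

/-- In an infinite run every call of `Reduction` that handles elements of a chain ends. -/
theorem Chain.exists_mem_G {c σ : ℕ → ℕ} {u : ℕ → Fin n →₀ ℕ} (hc : Chain ord run c σ u)
    (hstep : ∀ t, Step ord full (run t) (run (t + 1))) (hinv : ∀ t, Inv ord m (run t)) (j : ℕ) :
    ∃ t, σ j ≤ t ∧ c j ∈ (run t).G (run t).i := by
  by_contra! hG
  have hDone : ∀ t, σ j ≤ t →
      c j ∈ (run t).Done ∧ ((run t).pc = .reduce ∨ (run t).pc = .update) := by
    intro t ht
    induction t, ht using Nat.le_induction with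
    | base =>
      rcases hc.mem j with h | h
      · exact absurd h (hG _ le_rfl)
      · exact ⟨h.2.1, .inl h.1⟩
    | succ t ht ih =>
      exact ((hstep t).mem_done_or ih.1 ih.2).resolve_left (hG _ (ht.trans t.le_succ))
  -- If `c j` never reaches `G_i`, the run stays in `Reduction` forever: the update phase would
  -- freeze `N`.
  have hpc : ∀ t, σ j ≤ t → (run t).pc = .reduce := by
    intro t ht
    refine (hDone t ht).2.resolve_right fun hpc => ?_
    have hup : ∀ t', t ≤ t' → (run t').pc = .update ∧ (run t').N = (run t).N := by
      intro t' ht'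
      induction t', ht' using Nat.le_induction with
      | base => exact ⟨hpc, rfl⟩
      | succ t' ht' ih =>
        obtain ⟨h1, h2⟩ := (hstep t').update_eq ih.1 (hDone t' (ht.trans ht')).1
        exact ⟨h1, h2.trans ih.2⟩
    obtain ⟨t', ht'⟩ := exists_lt_N hstep hinv (run t).N
    have h1 := (hup (max t t') (le_max_left _ _)).2
    have h2 := (tracks_of_le hstep hinv (le_max_right t t')).N_le
    omega
  have hGeq : ∀ t, σ j ≤ t → (run t).i = (run (σ j)).i ∧ (run t).G = (run (σ j)).G := by
    intro t ht
    induction t, ht using Nat.le_induction with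
    | base => exact ⟨rfl, rfl⟩
    | succ t ht ih =>
      obtain ⟨h1, h2⟩ := (hstep t).reduce_eq (hpc t ht)
      exact ⟨h1.trans ih.1, h2.trans ih.2⟩
  have hcm : StrictMono c := strictMono_nat_of_lt_succ hc.c_lt
  have hσm : StrictMono σ := strictMono_nat_of_lt_succ hc.σ_lt
  -- As `G_i` is frozen, it contains only positions below `c (j + 1)`. Later parents therefore come
  -- from `Done` with multiplier `0`, and head monomials decrease forever.
  refine not_strictAnti_of_wellFoundedLT
    (fun j' => ord.toSyn ((run (σ j')).HM ord (c j'))) (j + 1) fun j' hj' => ?_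
  have h1 := hc.HM_lt j'
  rcases hc.mem j' with h | ⟨-, -, h⟩
  · obtain ⟨h2, h3⟩ := hGeq (σ j') (hσm.monotone (Nat.le_of_succ_le hj'))
    rw [h2, h3] at h
    have h4 := ((hinv _).mem_G _ _ h).1
    rw [hc.N_eq] at h4
    exact absurd (hcm.monotone hj') (not_le.2 h4)
  · rwa [h, zero_add] at h1

end Runs

end F5

/-! ### Dickson's lemma along the chain -/

theorem mainTheorem3 {K : Type*} [Field K] {n m : ℕ} (ord : MonomialOrder (Fin n)) (full : Prop)
    (f : Fin m → MvPolynomial (Fin n) K) (hf : ∀ j, f j ≠ 0)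
    (hhom : ∀ j, ∃ d, (f j).IsHomogeneous d)
    (run : ℕ → F5.State n K) (hrun : F5.IsInfiniteRun ord full f run) :
    ∃ (t₀ k' k : ℕ), k' < k ∧ ∀ t, t₀ ≤ t →
      k' ∈ (run t).G (run t).i ∧ k ∈ (run t).G (run t).i ∧
      ((run t).R k').poly ≠ 0 ∧ ((run t).R k).poly ≠ 0 ∧
      (run t).HM ord k' ≤ (run t).HM ord k ∧
      F5.QuotGt ord ((run t).HM ord k') ((run t).S k').mono
        ((run t).HM ord k) ((run t).S k).mono ∧
      ((run t).S k').Dvd ((run t).S k) := by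
  obtain ⟨h0, hstep⟩ := hrun
  have hinv : ∀ t, F5.Inv ord m (run t) := by
    intro t
    induction t with
    | zero => exact h0 ▸ F5.inv_init hf hhom
    | succ t ih => exact (hstep t).inv ih
  obtain ⟨c, σ, u, hc⟩ := F5.exists_chain hstep hinv (by rw [h0]; rfl)
  have hcm : StrictMono c := strictMono_nat_of_lt_succ hc.c_lt
  have hσm : StrictMono σ := strictMono_nat_of_lt_succ hc.σ_lt
  have hanti : Antitone fun t => (run t).i := antitone_nat_of_succ_le fun t => (hstep t).i_le
  obtain ⟨T, hT⟩ := WellFoundedLT.antitone_chain_condition hanti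
  have hi : ∀ t, T ≤ t → (run t).i = (run T).i := fun t ht => (hT t ht).symm
  have hmem : ∀ j, T ≤ j → ∃ t₁, σ j ≤ t₁ ∧ ∀ t, t₁ ≤ t → c j ∈ (run t).G (run t).i := by
    intro j hj
    obtain ⟨t₁, h1, h2⟩ := hc.exists_mem_G hstep hinv j
    exact ⟨t₁, h1, fun t ht => F5.mem_G_of_le hstep hi ((hj.trans hσm.le_apply).trans h1) ht h2⟩
  -- The shift by `T` puts all times `σ (T + j)` after the stabilization of `i`, as `σ` is strictly
  -- increasing.
  obtain ⟨a, b, hab, hle⟩ := wellQuasiOrdered_le fun j =>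
    (run (σ (T + j))).HM ord (c (T + j))
  have hab' : T + a < T + b := by omega
  obtain ⟨t₁, h1, h1'⟩ := hmem (T + a) (Nat.le_add_right _ _)
  obtain ⟨t₂, h2, h2'⟩ := hmem (T + b) (Nat.le_add_right _ _)
  obtain ⟨v, hv, hv'⟩ := hc.exists_mul hab'
  refine ⟨max t₁ t₂, c (T + a), c (T + b), hcm hab', fun t ht => ?_⟩
  obtain ⟨ht₁, ht₂⟩ := max_le_iff.1 ht
  have hRa := hc.R_eq hstep hinv (h1.trans ht₁)
  have hRb := hc.R_eq hstep hinv (h2.trans ht₂)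
  simp only [F5.State.HM, F5.State.S] at hle hv hv' ⊢
  rw [hRa, hRb]
  refine ⟨h1' t ht₁, h2' t ht₂, hc.poly_ne_zero _, hc.poly_ne_zero _, hle, ?_, v, hv⟩
  -- With `S(f) = v · S(f')`, the claim is `HM(f) < v · HM(f')` multiplied by the monomial of
  -- `S(f')`.
  rw [F5.QuotGt, hv]
  simp only [F5.Sig.mul]
  rw [map_add] at hv' ⊢
  rw [map_add, map_add, ← add_assoc, add_comm (ord.toSyn (ord.degree _)) (ord.toSyn v)]
  gcongr
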